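/- Let $q\in\mathbb C$, $q\neq 0$, not a root of unity, and fix $\ln q\in\mathbb C$ with $e^{\ln q}=q$. Let $U=U_q(\mathfrak{sl}_2)$ be the unital $\mathbb C$-algebra generated by $K,K^{-1},E,F$ with $KK^{-1}=K^{-1}K=1$, $KE=q^2EK$, $KF=q^{-2}FK$, $EF-FE=\frac{K-K^{-1}}{q-q^{-1}}$. Adjoin to it an element $H$ with $[H,K]=0$, $[H,E]=2E$, $[H,F]=-2F$, and let $\triangle$ (an algebra homomorphism) and $S$ (an algebra anti-homomorphism) be given by $\triangle(K^{\pm1})=K^{\pm1}\otimes K^{\pm1}$, $\triangle(E)=E\otimes K+1\otimes E$, $\triangle(F)=F\otimes 1+K^{-1}\otimes F$, $\triangle(H)=H\otimes 1+1\otimes H$, $S(K^{\pm1})=K^{\mp1}$, $S(E)=-EK^{-1}$, $S(F)=-KF$, $S(H)=-H$. Let $b\triangleright a=\sum b_{(1)}aS(b_{(2)})$ be the left adjoint action, and let $$R=\sum R_1\otimes R_2=\sum_{n,l\ge 0}\Big(\frac{\ln q}{2}\Big)^l\frac1{l!}\,q^{\frac{n(n+1)}2}\frac{(1-q^{-2})^n}{[n]_q!}\,H^lE^n\otimes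 H^lF^n,$$ where $[n]_q=\frac{q^n-q^{-n}}{q-q^{-1}}$ and $[n]_q!=[n]_q\cdots[1]_q$. For $m\ge0$ let $V_m$ be the irreducible module with basis $v_0,\dots,v_m$ and $Hv_i=(m-2i)v_i$, $K^{\pm1}v_i=q^{\pm(m-2i)}v_i$, $Fv_i=v_{i+1}$, $Ev_i=[i]_q[m-i+1]_qv_{i-1}$ (where $v_{-1}=v_{m+1}=0$). Infinite sums are taken in the completion $\prod_{m\ge0}\operatorname{End}V_m$ with the product topology, to which $U$ and $H$ are mapped by their actions on the $V_m$. Put $Cas_q=EF+\frac{qK^{-1}+q^{-1}K}{(q-q^{-1})^2}$. Then the series defining the braided antipode $\underline S a=\sum R_2\,S(R_1\triangleright a)$ converges in the completion for each of the generators $a=E,K,K^{-1},F$, and 1. $\underline S(E)=-q^2E$; 2. $\underline S(K)=K^{-1}+q(q-q^{-1})^2FE=-q^2K+q(q-q^{-1})^2Cas_q$; 3. $\underline S(K^{-1})=\sum_{n=0}^\infty(-1)^nq^{n^2+2n}(q-q^{-1})^{2n}K^{n+1}F^nE^n$; 4. $\underline S(F)=\sum_{n=0}^\infty(-1)^{n+1}q^{n^2+4n+4}(q-q^{-1})^{2n}K^{n+2}F^{n+1}E^n$;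 where the series in 3 and 4 converge in the completion. -/

import Mathlib

open scoped TensorProduct

noncomputable section

namespace BraidedUq

/-! ### The algebra `U_q(sl₂)` -/

/-- The four generators of `U_q(sl₂)`. -/
inductive Gen
  | K | Kinv | E | F

/-- The defining relations of `U_q(sl₂)`. -/
inductive Rel (q : ℂ) : FreeAlgebra ℂ Gen → FreeAlgebra ℂ Gen → Prop
  | K_Kinv : Rel q (FreeAlgebra.ι ℂ Gen.K * FreeAlgebra.ι ℂ Gen.Kinv) 1
  | Kinv_K : Rel q (FreeAlgebra.ι ℂ Gen.Kinv * FreeAlgebra.ι ℂ Gen.K) 1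
  | K_E : Rel q (FreeAlgebra.ι ℂ Gen.K * FreeAlgebra.ι ℂ Gen.E)
      (q ^ 2 • (FreeAlgebra.ι ℂ Gen.E * FreeAlgebra.ι ℂ Gen.K))
  | K_F : Rel q (FreeAlgebra.ι ℂ Gen.K * FreeAlgebra.ι ℂ Gen.F)
      ((q ^ 2)⁻¹ • (FreeAlgebra.ι ℂ Gen.F * FreeAlgebra.ι ℂ Gen.K))
  | E_F : Rel q (FreeAlgebra.ι ℂ Gen.E * FreeAlgebra.ι ℂ Gen.F
        - FreeAlgebra.ι ℂ Gen.F * FreeAlgebra.ι ℂ Gen.E)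
      ((q - q⁻¹)⁻¹ • (FreeAlgebra.ι ℂ Gen.K - FreeAlgebra.ι ℂ Gen.Kinv))

/-- The quantum enveloping algebra `U_q(sl₂)`, by generators and relations. -/
def Uq (q : ℂ) : Type := RingQuot (Rel q)

instance (q : ℂ) : Ring (Uq q) := inferInstanceAs (Ring (RingQuot (Rel q)))

instance (q : ℂ) : Algebra ℂ (Uq q) := inferInstanceAs (Algebra ℂ (RingQuot (Rel q)))

/-- The quotient map. -/
def Uq.mk (q : ℂ) : FreeAlgebra ℂ Gen →ₐ[ℂ] Uq q := RingQuot.mkAlgHom ℂ (Rel q)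

theorem Uq.mk_rel {q : ℂ} {x y : FreeAlgebra ℂ Gen} (h : Rel q x y) :
    Uq.mk q x = Uq.mk q y :=
  RingQuot.mkAlgHom_rel ℂ h

/-- The universal property of the presentation: a map of the generators that respects the relations
extends to an algebra homomorphism. -/
def Uq.lift {q : ℂ} {B : Type} [Ring B] [Algebra ℂ B] (f : Gen → B)
    (hf : ∀ ⦃x y⦄, Rel q x y → FreeAlgebra.lift ℂ f x = FreeAlgebra.lift ℂ f y) :
    Uq q →ₐ[ℂ] B :=
  RingQuot.liftAlgHom ℂ ⟨FreeAlgebra.lift ℂ f, hf⟩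

theorem Uq.lift_mk {q : ℂ} {B : Type} [Ring B] [Algebra ℂ B] (f : Gen → B)
    (hf : ∀ ⦃x y⦄, Rel q x y → FreeAlgebra.lift ℂ f x = FreeAlgebra.lift ℂ f y) (g : Gen) :
    Uq.lift f hf (Uq.mk q (FreeAlgebra.ι ℂ g)) = f g :=
  (RingQuot.liftAlgHom_mkAlgHom_apply ..).trans (FreeAlgebra.lift_ι_apply ..)

/-- The image in `U_q(sl₂)` of a generator. -/
def Uq.gen (q : ℂ) (g : Gen) : Uq q := Uq.mk q (FreeAlgebra.ι ℂ g)

/-- The generator `K`. -/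
abbrev Uq.K (q : ℂ) : Uq q := Uq.gen q Gen.K
/-- The generator `K⁻¹`. -/
abbrev Uq.Kinv (q : ℂ) : Uq q := Uq.gen q Gen.Kinv
/-- The generator `E`. -/
abbrev Uq.E (q : ℂ) : Uq q := Uq.gen q Gen.E
/-- The generator `F`. -/
abbrev Uq.F (q : ℂ) : Uq q := Uq.gen q Gen.F

/-- The quantum Casimir element `EF + (q K⁻¹ + q⁻¹ K) / (q - q⁻¹)²`. -/
def Uq.casimir (q : ℂ) : Uq q :=
  Uq.E q * Uq.F q + ((q - q⁻¹) ^ 2)⁻¹ • (q • Uq.Kinv q + q⁻¹ • Uq.K q)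

/-! ### Adjoining the Cartan element `H`

The `R`-matrix is a series in `H`, `E`, `F`.  The finite part of the completion in which it lives is
the Hopf algebra obtained from `U_q(sl₂)` by adjoining `H`; the relation `q ^ H = K` makes sense only
in the completion below, where it holds. -/

/-- The generators of `U_q(sl₂)` together with `H`. -/
inductive GenH
  | H | K | Kinv | E | F

/-- The relations of `U_q(sl₂)` together with `[H, K] = 0`, `[H, E] = 2E`, `[H, F] = -2F`
(these imply `[H, K⁻¹] = 0`). -/
inductive RelH (q : ℂ) : FreeAlgebra ℂ GenH → FreeAlgebra ℂ GenH → Prop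
  | K_Kinv : RelH q (FreeAlgebra.ι ℂ GenH.K * FreeAlgebra.ι ℂ GenH.Kinv) 1
  | Kinv_K : RelH q (FreeAlgebra.ι ℂ GenH.Kinv * FreeAlgebra.ι ℂ GenH.K) 1
  | K_E : RelH q (FreeAlgebra.ι ℂ GenH.K * FreeAlgebra.ι ℂ GenH.E)
      (q ^ 2 • (FreeAlgebra.ι ℂ GenH.E * FreeAlgebra.ι ℂ GenH.K))
  | K_F : RelH q (FreeAlgebra.ι ℂ GenH.K * FreeAlgebra.ι ℂ GenH.F)
      ((q ^ 2)⁻¹ • (FreeAlgebra.ι ℂ GenH.F * FreeAlgebra.ι ℂ GenH.K))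
  | E_F : RelH q (FreeAlgebra.ι ℂ GenH.E * FreeAlgebra.ι ℂ GenH.F
        - FreeAlgebra.ι ℂ GenH.F * FreeAlgebra.ι ℂ GenH.E)
      ((q - q⁻¹)⁻¹ • (FreeAlgebra.ι ℂ GenH.K - FreeAlgebra.ι ℂ GenH.Kinv))
  | H_K : RelH q (FreeAlgebra.ι ℂ GenH.H * FreeAlgebra.ι ℂ GenH.K)
      (FreeAlgebra.ι ℂ GenH.K * FreeAlgebra.ι ℂ GenH.H)
  | H_E : RelH q (FreeAlgebra.ι ℂ GenH.H * FreeAlgebra.ι ℂ GenH.E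
        - FreeAlgebra.ι ℂ GenH.E * FreeAlgebra.ι ℂ GenH.H)
      ((2 : ℂ) • FreeAlgebra.ι ℂ GenH.E)
  | H_F : RelH q (FreeAlgebra.ι ℂ GenH.H * FreeAlgebra.ι ℂ GenH.F
        - FreeAlgebra.ι ℂ GenH.F * FreeAlgebra.ι ℂ GenH.H)
      ((-2 : ℂ) • FreeAlgebra.ι ℂ GenH.F)

/-- `U_q(sl₂)` with `H` adjoined. -/
def UqH (q : ℂ) : Type := RingQuot (RelH q)

instance (q : ℂ) : Ring (UqH q) := inferInstanceAs (Ring (RingQuot (RelH q)))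

instance (q : ℂ) : Algebra ℂ (UqH q) := inferInstanceAs (Algebra ℂ (RingQuot (RelH q)))

/-- The quotient map. -/
def UqH.mk (q : ℂ) : FreeAlgebra ℂ GenH →ₐ[ℂ] UqH q := RingQuot.mkAlgHom ℂ (RelH q)

theorem UqH.mk_rel {q : ℂ} {x y : FreeAlgebra ℂ GenH} (h : RelH q x y) :
    UqH.mk q x = UqH.mk q y :=
  RingQuot.mkAlgHom_rel ℂ h

/-- The universal property of the presentation: a map of the generators that respects the relations
extends to an algebra homomorphism. -/
def UqH.lift {q : ℂ} {B : Type} [Ring B] [Algebra ℂ B] (f : GenH → B)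
    (hf : ∀ ⦃x y⦄, RelH q x y → FreeAlgebra.lift ℂ f x = FreeAlgebra.lift ℂ f y) :
    UqH q →ₐ[ℂ] B :=
  RingQuot.liftAlgHom ℂ ⟨FreeAlgebra.lift ℂ f, hf⟩

theorem UqH.lift_mk {q : ℂ} {B : Type} [Ring B] [Algebra ℂ B] (f : GenH → B)
    (hf : ∀ ⦃x y⦄, RelH q x y → FreeAlgebra.lift ℂ f x = FreeAlgebra.lift ℂ f y) (g : GenH) :
    UqH.lift f hf (UqH.mk q (FreeAlgebra.ι ℂ g)) = f g :=
  (RingQuot.liftAlgHom_mkAlgHom_apply ..).trans (FreeAlgebra.lift_ι_apply ..)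

/-- The image in `UqH q` of a generator. -/
def UqH.gen (q : ℂ) (g : GenH) : UqH q := UqH.mk q (FreeAlgebra.ι ℂ g)

/-- The element `H`. -/
abbrev UqH.H (q : ℂ) : UqH q := UqH.gen q GenH.H
/-- The element `K`. -/
abbrev UqH.K (q : ℂ) : UqH q := UqH.gen q GenH.K
/-- The element `K⁻¹`. -/
abbrev UqH.Kinv (q : ℂ) : UqH q := UqH.gen q GenH.Kinv
/-- The element `E`. -/
abbrev UqH.E (q : ℂ) : UqH q := UqH.gen q GenH.E
/-- The element `F`. -/
abbrev UqH.F (q : ℂ) : UqH q := UqH.gen q GenH.F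

section relations
variable (q : ℂ)

theorem UqH.K_Kinv : UqH.K q * UqH.Kinv q = 1 := by
  simpa [UqH.gen] using UqH.mk_rel (RelH.K_Kinv (q := q))

theorem UqH.Kinv_K : UqH.Kinv q * UqH.K q = 1 := by
  simpa [UqH.gen] using UqH.mk_rel (RelH.Kinv_K (q := q))

theorem UqH.K_E : UqH.K q * UqH.E q = q ^ 2 • (UqH.E q * UqH.K q) := by
  simpa only [UqH.gen, map_mul, map_smul] using UqH.mk_rel (RelH.K_E (q := q))

theorem UqH.K_F : UqH.K q * UqH.F q = (q ^ 2)⁻¹ • (UqH.F q * UqH.K q) := by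
  simpa only [UqH.gen, map_mul, map_smul] using UqH.mk_rel (RelH.K_F (q := q))

theorem UqH.E_F : UqH.E q * UqH.F q - UqH.F q * UqH.E q
    = (q - q⁻¹)⁻¹ • (UqH.K q - UqH.Kinv q) := by
  simpa only [UqH.gen, map_mul, map_smul, map_sub] using
    UqH.mk_rel (RelH.E_F (q := q))

theorem UqH.H_K : UqH.H q * UqH.K q = UqH.K q * UqH.H q := by
  simpa only [UqH.gen, map_mul] using UqH.mk_rel (RelH.H_K (q := q))

theorem UqH.H_E : UqH.H q * UqH.E q - UqH.E q * UqH.H q = (2 : ℂ) • UqH.E q := by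
  simpa only [UqH.gen, map_mul, map_smul, map_sub] using
    UqH.mk_rel (RelH.H_E (q := q))

theorem UqH.H_F : UqH.H q * UqH.F q - UqH.F q * UqH.H q = (-2 : ℂ) • UqH.F q := by
  simpa only [UqH.gen, map_mul, map_smul, map_sub] using
    UqH.mk_rel (RelH.H_F (q := q))

theorem UqH.H_Kinv : UqH.H q * UqH.Kinv q = UqH.Kinv q * UqH.H q := by
  calc UqH.H q * UqH.Kinv q
      = UqH.Kinv q * (UqH.K q * UqH.H q) * UqH.Kinv q := by
        rw [← mul_assoc, UqH.Kinv_K, one_mul]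
    _ = UqH.Kinv q * (UqH.H q * UqH.K q) * UqH.Kinv q := by rw [UqH.H_K]
    _ = UqH.Kinv q * UqH.H q := by
        rw [mul_assoc, mul_assoc, UqH.K_Kinv, mul_one]

theorem UqH.E_Kinv : UqH.E q * UqH.Kinv q = q ^ 2 • (UqH.Kinv q * UqH.E q) := by
  calc UqH.E q * UqH.Kinv q
      = UqH.Kinv q * (UqH.K q * UqH.E q) * UqH.Kinv q := by
        rw [← mul_assoc, UqH.Kinv_K, one_mul]
    _ = q ^ 2 • (UqH.Kinv q * UqH.E q) := by
        rw [UqH.K_E, mul_smul_comm, smul_mul_assoc, mul_assoc, mul_assoc, UqH.K_Kinv, mul_one]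

variable [NeZero q]

theorem UqH.F_K : UqH.F q * UqH.K q = q ^ 2 • (UqH.K q * UqH.F q) := by
  rw [UqH.K_F, smul_smul, mul_inv_cancel₀ (pow_ne_zero 2 (NeZero.ne q)), one_smul]

theorem UqH.Kinv_F : UqH.Kinv q * UqH.F q = q ^ 2 • (UqH.F q * UqH.Kinv q) := by
  calc UqH.Kinv q * UqH.F q
      = UqH.Kinv q * (UqH.F q * UqH.K q) * UqH.Kinv q := by
        rw [mul_assoc, mul_assoc, UqH.K_Kinv, mul_one]
    _ = q ^ 2 • (UqH.F q * UqH.Kinv q) := by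
        rw [UqH.F_K, mul_smul_comm, smul_mul_assoc, ← mul_assoc, UqH.Kinv_K, one_mul]

end relations

/-- The canonical homomorphism from `U_q(sl₂)` to `UqH q`. -/
def incl (q : ℂ) : Uq q →ₐ[ℂ] UqH q :=
  Uq.lift (fun g : Gen => match g with
      | Gen.K => UqH.K q
      | Gen.Kinv => UqH.Kinv q
      | Gen.E => UqH.E q
      | Gen.F => UqH.F q) (by
    intro x y h
    cases h
    · simpa using UqH.K_Kinv q
    · simpa using UqH.Kinv_K q
    · simpa using UqH.K_E q
    · simpa using UqH.K_F q
    · simpa using UqH.E_F q)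

/-! ### Coproduct, antipode and adjoint action -/

section hopf
variable (q : ℂ) [NeZero q]

/-- The values of the coproduct on the generators. -/
def comulGen : GenH → UqH q ⊗[ℂ] UqH q
  | GenH.H => UqH.H q ⊗ₜ 1 + 1 ⊗ₜ UqH.H q
  | GenH.K => UqH.K q ⊗ₜ UqH.K q
  | GenH.Kinv => UqH.Kinv q ⊗ₜ UqH.Kinv q
  | GenH.E => UqH.E q ⊗ₜ UqH.K q + 1 ⊗ₜ UqH.E q
  | GenH.F => UqH.F q ⊗ₜ 1 + UqH.Kinv q ⊗ₜ UqH.F q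

/-- The coproduct, as an algebra homomorphism. -/
def comul : UqH q →ₐ[ℂ] UqH q ⊗[ℂ] UqH q :=
  UqH.lift (comulGen q) (by
    intro x y h
    cases h
    · simp [comulGen, UqH.K_Kinv, Algebra.TensorProduct.one_def]
    · simp [comulGen, UqH.Kinv_K, Algebra.TensorProduct.one_def]
    · simp [comulGen, mul_add, add_mul, UqH.K_E, TensorProduct.tmul_smul,
        TensorProduct.smul_tmul']
    · simp [comulGen, mul_add, add_mul, UqH.K_F, TensorProduct.tmul_smul,
        TensorProduct.smul_tmul', UqH.K_Kinv, UqH.Kinv_K]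
    · have h1 := UqH.E_F q
      rw [sub_eq_iff_eq_add] at h1
      simp [comulGen, mul_add, add_mul, h1, UqH.E_Kinv, UqH.F_K, TensorProduct.tmul_smul,
        TensorProduct.add_tmul, TensorProduct.tmul_add, TensorProduct.sub_tmul,
        TensorProduct.tmul_sub, ← TensorProduct.smul_tmul', smul_sub]
      abel
    · simp [comulGen, mul_add, add_mul, UqH.H_K]
    · have h1 := UqH.H_E q
      rw [sub_eq_iff_eq_add] at h1
      simp [comulGen, mul_add, add_mul, h1, UqH.H_K, TensorProduct.tmul_smul,
        TensorProduct.add_tmul, TensorProduct.tmul_add, ← TensorProduct.smul_tmul']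
      abel
    · have h1 : UqH.H q * UqH.F q = UqH.F q * UqH.H q - (2 : ℂ) • UqH.F q := by
        rw [sub_eq_add_neg, ← neg_smul, ← UqH.H_F q]
        abel
      simp only [map_mul, map_sub, map_smul, FreeAlgebra.lift_ι_apply, comulGen, mul_add, add_mul,
        Algebra.TensorProduct.tmul_mul_tmul, one_mul, mul_one, h1, UqH.H_Kinv,
        TensorProduct.tmul_smul, TensorProduct.tmul_sub, TensorProduct.sub_tmul,
        ← TensorProduct.smul_tmul']
      simp only [neg_smul, smul_add]
      abel)

/-- The values of the antipode on the generators. -/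
def antipodeGen : GenH → UqH q
  | GenH.H => -UqH.H q
  | GenH.K => UqH.Kinv q
  | GenH.Kinv => UqH.K q
  | GenH.E => -(UqH.E q * UqH.Kinv q)
  | GenH.F => -(UqH.K q * UqH.F q)

/-- The antipode as an algebra homomorphism to the opposite algebra, i.e. an
anti-homomorphism. -/
def antipodeOp : UqH q →ₐ[ℂ] (UqH q)ᵐᵒᵖ :=
  UqH.lift (fun g => MulOpposite.op (antipodeGen q g)) (by
    intro x y h
    cases h <;> apply MulOpposite.unop_injective
    · simp [antipodeGen, UqH.K_Kinv]
    · simp [antipodeGen, UqH.Kinv_K]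
    · simp [antipodeGen, UqH.E_Kinv, ← mul_assoc]
    · have h1 : UqH.K q * UqH.F q * UqH.Kinv q = (q ^ 2)⁻¹ • UqH.F q := by
        rw [UqH.K_F, smul_mul_assoc, mul_assoc, UqH.K_Kinv, mul_one]
      have h2 : UqH.Kinv q * (UqH.K q * UqH.F q) = UqH.F q := by
        rw [← mul_assoc, UqH.Kinv_K, one_mul]
      simp [antipodeGen, h1, h2]
    · have h1 := UqH.E_F q
      rw [sub_eq_iff_eq_add] at h1
      have h2 : UqH.K q * UqH.F q * (UqH.E q * UqH.Kinv q) = UqH.F q * UqH.E q := by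
        rw [UqH.E_Kinv, mul_smul_comm, ← mul_assoc, UqH.K_F, smul_mul_assoc,
          mul_assoc (UqH.F q), UqH.K_Kinv, mul_one, smul_mul_assoc, smul_smul,
          mul_inv_cancel₀ (pow_ne_zero 2 (NeZero.ne q)), one_smul]
      have h3 : UqH.E q * UqH.Kinv q * (UqH.K q * UqH.F q) = UqH.E q * UqH.F q := by
        rw [mul_assoc, ← mul_assoc (UqH.Kinv q), UqH.Kinv_K, one_mul]
      simp [antipodeGen, h2, h3, h1, smul_sub]
    · simp [antipodeGen, UqH.H_Kinv]
    · have h1 := UqH.H_E q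
      rw [sub_eq_iff_eq_add] at h1
      simp [antipodeGen, ← mul_assoc, h1, add_mul]
      simp [mul_assoc, UqH.H_Kinv]
    · have h1 := UqH.H_F q
      rw [sub_eq_iff_eq_add] at h1
      simp [antipodeGen, ← mul_assoc, UqH.H_K]
      simp [mul_assoc, h1, mul_add])

/-- The antipode `S`. -/
def antipode : UqH q →ₗ[ℂ] UqH q :=
  (MulOpposite.opLinearEquiv ℂ).symm.toLinearMap ∘ₗ (antipodeOp q).toLinearMap

/-- The left adjoint action `b ▷ a = ∑ b₍₁₎ a S(b₍₂₎)`. -/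
def ad (b a : UqH q) : UqH q :=
  (LinearMap.mul' ℂ (UqH q) ∘ₗ
    TensorProduct.map (LinearMap.mulRight ℂ a) (antipode q)) (comul q b)

end hopf

/-! ### The `R`-matrix -/

/-- The `q`-number `[n]_q = (q ^ n - q ^ (-n)) / (q - q⁻¹)`. -/
def qNumber (q : ℂ) (n : ℤ) : ℂ := (q ^ n - q ^ (-n)) / (q - q⁻¹)

/-- The `q`-factorial `[n]_q! = [n]_q [n-1]_q ⋯ [1]_q`. -/
def qFactorial (q : ℂ) (n : ℕ) : ℂ := ∏ j ∈ Finset.range n, qNumber q (j + 1)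

/-- The term with index `(n, l)` of the series
`R = ∑ₙ ∑ₗ (ln q / 2) ^ l / l! * q ^ (n(n+1)/2) (1 - q⁻²) ^ n / [n]_q! • (H ^ l E ^ n ⊗ H ^ l F ^ n)`,
where `lnq` is a logarithm of `q`. -/
def RTerm (q lnq : ℂ) (p : ℕ × ℕ) : UqH q ⊗[ℂ] UqH q :=
  ((lnq / 2) ^ p.2 / (p.2.factorial : ℂ) *
      (q ^ (p.1 * (p.1 + 1) / 2) * (1 - (q ^ 2)⁻¹) ^ p.1 / qFactorial q p.1)) •
    ((UqH.H q ^ p.2 * UqH.E q ^ p.1) ⊗ₜ[ℂ] (UqH.H q ^ p.2 * UqH.F q ^ p.1))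

/-! ### The completion

For `q` not a root of unity the finite dimensional type 1 modules over `U_q(sl₂)` are the direct sums
of the irreducible modules `V₀, V₁, V₂, …` with `dim Vₘ = m + 1`, and these separate the points of
`U_q(sl₂)`.  The completion is the algebra of natural endomorphisms of the forgetful functor on
these modules, that is, the product of the matrix algebras `End Vₘ`, with the product topology:
convergence is convergence in each `Vₘ`. -/

/-- The completion `∏ₘ End Vₘ`, where `End Vₘ` is the algebra of `(m+1) × (m+1)` matrices. -/
abbrev Completion : Type := (m : ℕ) → Matrix (Fin (m + 1)) (Fin (m + 1)) ℂ

/-- The action of the generators on `Vₘ` in the basis `v₀, …, vₘ` with `H vᵢ = (m - 2i) vᵢ`,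
`K vᵢ = q ^ (m - 2i) vᵢ`, `F vᵢ = vᵢ₊₁` and `E vᵢ = [i]_q [m - i + 1]_q vᵢ₋₁`. -/
def repGen (q : ℂ) (m : ℕ) : GenH → Matrix (Fin (m + 1)) (Fin (m + 1)) ℂ
  | GenH.H => Matrix.diagonal fun i => (m : ℂ) - 2 * ((i : ℕ) : ℂ)
  | GenH.K => Matrix.diagonal fun i => q ^ ((m : ℤ) - 2 * ((i : ℕ) : ℤ))
  | GenH.Kinv => Matrix.diagonal fun i => q ^ (-((m : ℤ) - 2 * ((i : ℕ) : ℤ)))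
  | GenH.E => Matrix.of fun j i =>
      if (j : ℕ) + 1 = i then qNumber q (i : ℕ) * qNumber q ((m : ℤ) - (i : ℕ) + 1) else 0
  | GenH.F => Matrix.of fun j i => if (j : ℕ) = i + 1 then 1 else 0

section rep
variable (q : ℂ) (m : ℕ)

theorem repGen_E_F : repGen q m GenH.E * repGen q m GenH.F = Matrix.diagonal fun i : Fin (m + 1) =>
    qNumber q ((i : ℕ) + 1) * qNumber q ((m : ℤ) - (i : ℕ)) := by
  ext a b
  rw [Matrix.mul_apply, Matrix.diagonal_apply]
  by_cases hb : (b : ℕ) + 1 < m + 1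
  · rw [Finset.sum_eq_single (⟨b + 1, hb⟩ : Fin (m + 1))]
    · have : a = b ↔ (a : ℕ) = b := Fin.ext_iff
      simp only [repGen, Matrix.of_apply, this]
      by_cases h : (a : ℕ) = b
      · simp [h, show (m : ℤ) - ((b : ℕ) + 1) + 1 = m - (b : ℕ) by ring]
      · simp [h]
    · intro c _ hc
      have : (c : ℕ) ≠ b + 1 := fun h => hc (Fin.ext h)
      simp [repGen, this]
    · simp
  · have hbm : (b : ℕ) = m := by omega
    rw [Finset.sum_eq_zero]
    · split_ifs with h
      · subst h
        simp [hbm, qNumber]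
      · rfl
    · intro c _
      have : (c : ℕ) ≠ b + 1 := by omega
      simp [repGen, this]

theorem repGen_F_E : repGen q m GenH.F * repGen q m GenH.E = Matrix.diagonal fun i : Fin (m + 1) =>
    qNumber q (i : ℕ) * qNumber q ((m : ℤ) - (i : ℕ) + 1) := by
  ext a b
  rw [Matrix.mul_apply, Matrix.diagonal_apply]
  by_cases ha : (a : ℕ) = 0
  · rw [Finset.sum_eq_zero]
    · split_ifs with h
      · simp [ha, qNumber]
      · rfl
    · intro c _
      simp [repGen, ha]
  · rw [Finset.sum_eq_single (⟨a - 1, by omega⟩ : Fin (m + 1))]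
    · have : a = b ↔ (a : ℕ) = b := Fin.ext_iff
      have h1 : (a : ℕ) = a - 1 + 1 := by omega
      simp only [repGen, Matrix.of_apply, this, ← h1]
      by_cases h : (a : ℕ) = b
      · simp [h]
      · simp [h]
    · intro c _ hc
      have : (a : ℕ) ≠ c + 1 := fun h => hc (Fin.ext (by simp; omega))
      simp [repGen, this]
    · simp

variable [NeZero q]

/-- The irreducible representation of `UqH q` on `Vₘ`. -/
def rep : UqH q →ₐ[ℂ] Matrix (Fin (m + 1)) (Fin (m + 1)) ℂ :=
  UqH.lift (repGen q m) (by
    have hq : q ≠ 0 := NeZero.ne q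
    intro x y h
    cases h
    · simp only [map_mul, FreeAlgebra.lift_ι_apply, map_one, repGen, Matrix.diagonal_mul_diagonal]
      rw [← Matrix.diagonal_one]
      congr 1
      ext i
      rw [← zpow_add₀ hq, add_neg_cancel, zpow_zero]
    · simp only [map_mul, FreeAlgebra.lift_ι_apply, map_one, repGen, Matrix.diagonal_mul_diagonal]
      rw [← Matrix.diagonal_one]
      congr 1
      ext i
      rw [← zpow_add₀ hq, neg_add_cancel, zpow_zero]
    · ext a b
      simp only [map_mul, map_smul, FreeAlgebra.lift_ι_apply, repGen, Matrix.diagonal_mul,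
        Matrix.smul_apply, Matrix.mul_diagonal, Matrix.of_apply, smul_eq_mul]
      split_ifs with h
      · rw [show (m : ℤ) - 2 * (a : ℕ) = ((m : ℤ) - 2 * (b : ℕ)) + (2 : ℕ) by omega,
          zpow_add₀ hq, zpow_natCast]
        ring
      · simp
    · ext a b
      simp only [map_mul, map_smul, FreeAlgebra.lift_ι_apply, repGen, Matrix.diagonal_mul,
        Matrix.smul_apply, Matrix.mul_diagonal, Matrix.of_apply, smul_eq_mul]
      split_ifs with h
      · rw [show (m : ℤ) - 2 * (b : ℕ) = ((m : ℤ) - 2 * (a : ℕ)) + (2 : ℕ) by omega,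
          zpow_add₀ hq, zpow_natCast]
        field_simp
      · simp
    · simp only [map_mul, map_sub, map_smul, FreeAlgebra.lift_ι_apply, repGen_E_F, repGen_F_E]
      simp only [repGen, Matrix.diagonal_sub, ← Matrix.diagonal_smul]
      congr 1
      ext i
      simp only [Pi.smul_apply, smul_eq_mul, qNumber]
      by_cases hd : q - q⁻¹ = 0
      · simp [hd]
      · have h1 : q ^ (i : ℕ) ≠ 0 := pow_ne_zero _ hq
        have h2 : q ^ m ≠ 0 := pow_ne_zero _ hq
        rw [div_mul_div_comm, div_mul_div_comm, ← sub_div, inv_mul_eq_div, div_eq_div_iff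
          (mul_ne_zero hd hd) hd]
        simp only [zpow_add₀ hq, zpow_sub₀ hq, zpow_neg, two_mul, zpow_natCast, zpow_one]
        field_simp
        ring
    · simp only [map_mul, FreeAlgebra.lift_ι_apply, repGen, Matrix.diagonal_mul_diagonal]
      congr 1
      ext i
      ring
    · ext a b
      simp only [map_mul, map_sub, map_smul, FreeAlgebra.lift_ι_apply, repGen,
        Matrix.diagonal_mul, Matrix.sub_apply, Matrix.smul_apply, Matrix.mul_diagonal,
        Matrix.of_apply, smul_eq_mul]
      split_ifs with h
      · rw [← h]
        push_cast
        ring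
      · simp
    · ext a b
      simp only [map_mul, map_sub, map_smul, FreeAlgebra.lift_ι_apply, repGen,
        Matrix.diagonal_mul, Matrix.sub_apply, Matrix.smul_apply, Matrix.mul_diagonal,
        Matrix.of_apply, smul_eq_mul]
      split_ifs with h
      · rw [h]
        push_cast
        ring
      · simp)

end rep

section braided
variable (q : ℂ) [NeZero q]

/-- The map from `UqH q` to the completion, given by the action on all the modules `Vₘ`. -/
def toCompletion : UqH q →ₐ[ℂ] Completion := AlgHom.pi fun m => rep q m

/-- The canonical map from `U_q(sl₂)` to its completion. -/
def Uq.toCompletion : Uq q →ₐ[ℂ] Completion := (BraidedUq.toCompletion q).comp (incl q)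

/-- The linear map `r₁ ⊗ r₂ ↦ r₂ S(r₁ ▷ a)`. -/
def antipodeFormula (a : UqH q) : UqH q ⊗[ℂ] UqH q →ₗ[ℂ] UqH q :=
  TensorProduct.lift (LinearMap.mk₂ ℂ (fun r₁ r₂ => r₂ * antipode q (ad q r₁ a))
    (by intros; simp [ad, mul_add]) (by intros; simp [ad])
    (by intros; simp [add_mul]) (by intros; simp))

/-- The term with index `(n, l)` of the series `∑ R₂ S(R₁ ▷ a)`, in the completion. -/
def braidedAntipodeTerm (lnq : ℂ) (a : Uq q) (p : ℕ × ℕ) : Completion :=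
  toCompletion q (antipodeFormula q (incl q a) (RTerm q lnq p))

/-- The braided antipode `a ↦ ∑ R₂ S(R₁ ▷ a)`, with values in the completion. -/
def braidedAntipode (lnq : ℂ) (a : Uq q) : Completion :=
  ∑' p : ℕ × ℕ, braidedAntipodeTerm q lnq a p

end braided

end BraidedUq

end

/-!
The adjoint action is an action of the algebra (`ad_mul`), and `ad H` is the commutator with `H`, so
that an element `a` of weight `2k` satisfies `(HˡEⁿ) ▷ a = (2k + 2n)ˡ (Eⁿ ▷ a)`
(`ad_H_pow_mul_E_pow`). For fixed `n` the sum over `l` in the series for the braided antipode is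
therefore an exponential series in `H`, which in every `Vₘ` sums to `q ^ ((k + n) H) = K ^ (k + n)`
(`hasSum_rep_H_pow`). This leaves the elements `cₙ K ^ (k + n) Fⁿ S(Eⁿ ▷ a)` of `UqH q`
(`braidedAntipodeRow`), with `cₙ` the coefficient of the `R`-matrix. Since `Fⁿ` acts by zero on `Vₘ`
for `n > m`, only finitely many `n` matter in each `Vₘ`; this gives both the convergence of the
double series and its equality with the sum of the rows (`exists_hasSum_braidedAntipode`).

It remains to compute `Eⁿ ▷ a`, where `E ▷ a = [E, a] K⁻¹`. One finds `E ▷ E = 0` and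
`E ▷ K = (1 - q²) E`, hence finite sums, while
`Eⁿ ▷ K⁻ᵖ = ∏_{j < n} (1 - q ^ (-2 (j + p))) Eⁿ K ^ (-n - p)` (`ad_E_pow_Kinv_pow`). For `p = 1` the
product cancels the `q`-factorial in `cₙ` (`RCoeff_mul_prod`), which gives the value on `K⁻¹`. For `F`
one has `E ▷ F = (1 - K⁻²) / (q - q⁻¹)`, which reduces to the case `p = 2`; the constant term
contributes `F` at `n = 1`, and this cancels the row `-F` at `n = 0`, so that the series is shifted by
one (`braidedAntipodeRow_F_succ`).
-/

open scoped TensorProduct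

noncomputable section

namespace BraidedUq

/-! ### Integer powers of `K`, coefficients of the `R`-matrix and weights -/

theorem K_pow_mul_Kinv_pow (q : ℂ) (n : ℕ) : UqH.K q ^ n * UqH.Kinv q ^ n = 1 := by
  have h : Commute (UqH.K q) (UqH.Kinv q) := (UqH.K_Kinv q).trans (UqH.Kinv_K q).symm
  rw [← h.mul_pow, UqH.K_Kinv, one_pow]

/-- `K` as a unit, so that it has integer powers. -/
def KUnit (q : ℂ) : (UqH q)ˣ := ⟨UqH.K q, UqH.Kinv q, UqH.K_Kinv q, UqH.Kinv_K q⟩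

theorem KUnit_zpow_natCast (q : ℂ) (n : ℕ) :
    ((KUnit q ^ (n : ℤ) : (UqH q)ˣ) : UqH q) = UqH.K q ^ n := by
  rw [zpow_natCast, Units.val_pow_eq_pow_val]; rfl

/-- The coefficient of `Eⁿ ⊗ Fⁿ` in the `R`-matrix. -/
def RCoeff (q : ℂ) (n : ℕ) : ℂ :=
  q ^ (n * (n + 1) / 2) * (1 - (q ^ 2)⁻¹) ^ n / qFactorial q n

theorem RCoeff_zero (q : ℂ) : RCoeff q 0 = 1 := by simp [RCoeff, qFactorial]

/-- Half of the `H`-weight of a generator. -/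
def Gen.halfWeight : Gen → ℤ
  | Gen.K => 0
  | Gen.Kinv => 0
  | Gen.E => 1
  | Gen.F => -1

theorem incl_gen (q : ℂ) (g : Gen) : incl q (Uq.gen q g) = match g with
    | Gen.K => UqH.K q
    | Gen.Kinv => UqH.Kinv q
    | Gen.E => UqH.E q
    | Gen.F => UqH.F q := by
  cases g <;> simp [incl, Uq.gen, Uq.lift_mk]

variable (q : ℂ) [NeZero q]

/-! ### The antipode and the adjoint action -/

theorem antipode_one : antipode q 1 = 1 := by simp [antipode]

theorem antipode_mul (x y : UqH q) : antipode q (x * y) = antipode q y * antipode q x := by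
  simp [antipode]

theorem antipode_pow (x : UqH q) (n : ℕ) : antipode q (x ^ n) = antipode q x ^ n := by
  simp [antipode]

theorem antipode_gen (g : GenH) : antipode q (UqH.gen q g) = antipodeGen q g := by
  simp [antipode, antipodeOp, UqH.gen, UqH.lift_mk]

theorem comul_gen (g : GenH) : comul q (UqH.gen q g) = comulGen q g := by
  simp [comul, UqH.gen, UqH.lift_mk]

theorem ad_one (a : UqH q) : ad q 1 a = a := by
  simp [ad, Algebra.TensorProduct.one_def, antipode_one]

theorem ad_smul (b : UqH q) (c : ℂ) (a : UqH q) : ad q b (c • a) = c • ad q b a := by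
  unfold ad
  induction comul q b using TensorProduct.induction_on with
  | zero => simp
  | tmul x y => simp
  | add x y hx hy => rw [map_add, map_add, hx, hy, smul_add]

theorem ad_sub (b a a' : UqH q) : ad q b (a - a') = ad q b a - ad q b a' := by
  unfold ad
  induction comul q b using TensorProduct.induction_on with
  | zero => simp
  | tmul x y => simp [mul_sub, sub_mul]
  | add x y hx hy => rw [map_add, map_add, map_add, hx, hy, add_sub_add_comm]

theorem ad_zero (b : UqH q) : ad q b 0 = 0 := by
  simpa using ad_sub q b 0 0

/-- The adjoint action is an action of the algebra: the coproduct is multiplicative and the antipode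
reverses products. -/
theorem ad_mul (b c a : UqH q) : ad q (b * c) a = ad q b (ad q c a) := by
  unfold ad
  rw [map_mul]
  induction comul q b using TensorProduct.induction_on with
  | zero => simp
  | add x y hx hy => rw [add_mul, map_add, map_add, hx, hy]
  | tmul x y =>
    induction comul q c using TensorProduct.induction_on with
    | zero => simp
    | add u v hu hv => rw [mul_add, map_add, map_add, hu, hv]; simp [mul_add, add_mul]
    | tmul u v => simp [antipode_mul, mul_assoc]

theorem ad_H (a : UqH q) : ad q (UqH.H q) a = UqH.H q * a - a * UqH.H q := by
  simp [ad, comul_gen, comulGen, antipode_gen, antipodeGen, antipode_one, sub_eq_add_neg]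

theorem ad_E (a : UqH q) : ad q (UqH.E q) a = (UqH.E q * a - a * UqH.E q) * UqH.Kinv q := by
  simp [ad, comul_gen, comulGen, antipode_gen, antipodeGen, sub_eq_add_neg, add_mul, mul_assoc]

variable {q} in
/-- The adjoint action of `E` raises weights by `2`. -/
theorem ad_H_ad_E_pow {w : ℂ} {a : UqH q} (ha : ad q (UqH.H q) a = w • a) (n : ℕ) :
    ad q (UqH.H q) (ad q (UqH.E q ^ n) a) = (w + 2 * n) • ad q (UqH.E q ^ n) a := by
  induction n with
  | zero => simpa [ad_one] using ha
  | succ n ih =>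
    have hHE : UqH.H q * UqH.E q = (2 : ℂ) • UqH.E q + UqH.E q * UqH.H q := by
      rw [← UqH.H_E]; abel
    have hadd (x y b : UqH q) : ad q (x + y) b = ad q x b + ad q y b := by simp [ad]
    have hsmul (c : ℂ) (x b : UqH q) : ad q (c • x) b = c • ad q x b := by simp [ad]
    rw [pow_succ', ad_mul, ← ad_mul q (UqH.H q), hHE, hadd, hsmul, ad_mul, ih, ad_smul, ← add_smul]
    push_cast
    ring_nf

variable {q} in
theorem ad_H_pow_mul_E_pow {w : ℂ} {a : UqH q} (ha : ad q (UqH.H q) a = w • a) (n l : ℕ) :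
    ad q (UqH.H q ^ l * UqH.E q ^ n) a = (w + 2 * n) ^ l • ad q (UqH.E q ^ n) a := by
  induction l with
  | zero => simp
  | succ l ih =>
    rw [pow_succ', mul_assoc, ad_mul, ih, ad_smul, ad_H_ad_E_pow ha, smul_smul, ← pow_succ]

/-! ### Commutation relations for powers -/

theorem Kinv_pow_mul_E (p : ℕ) :
    UqH.Kinv q ^ p * UqH.E q = (q ^ 2)⁻¹ ^ p • (UqH.E q * UqH.Kinv q ^ p) := by
  have h : UqH.Kinv q * UqH.E q = (q ^ 2)⁻¹ • (UqH.E q * UqH.Kinv q) := by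
    rw [UqH.E_Kinv, smul_smul, inv_mul_cancel₀ (pow_ne_zero 2 (NeZero.ne q)), one_smul]
  induction p with
  | zero => simp
  | succ p ih =>
    rw [pow_succ, mul_assoc, h, mul_smul_comm, ← mul_assoc, ih, smul_mul_assoc, smul_smul,
      mul_assoc, ← pow_succ']

theorem F_mul_K_pow (p : ℕ) :
    UqH.F q * UqH.K q ^ p = q ^ (2 * p) • (UqH.K q ^ p * UqH.F q) := by
  induction p with
  | zero => simp
  | succ p ih =>
    rw [pow_succ, ← mul_assoc, ih, smul_mul_assoc, mul_assoc, UqH.F_K, mul_smul_comm, smul_smul,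
      ← mul_assoc]
    ring_nf

theorem F_pow_mul_K_pow (n p : ℕ) :
    UqH.F q ^ n * UqH.K q ^ p = q ^ (2 * n * p) • (UqH.K q ^ p * UqH.F q ^ n) := by
  induction n with
  | zero => simp
  | succ n ih =>
    rw [pow_succ' (UqH.F q), mul_assoc, ih, mul_smul_comm, ← mul_assoc, F_mul_K_pow,
      smul_mul_assoc, smul_smul, ← pow_add, mul_assoc (UqH.K q ^ p),
      show 2 * n * p + 2 * p = 2 * (n + 1) * p by ring]

theorem E_mul_Kinv_pow (p : ℕ) :
    UqH.E q * UqH.Kinv q ^ p = q ^ (2 * p) • (UqH.Kinv q ^ p * UqH.E q) := by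
  rw [Kinv_pow_mul_E, smul_smul, pow_mul, ← mul_pow,
    mul_inv_cancel₀ (pow_ne_zero 2 (NeZero.ne q)), one_pow, one_smul]

theorem E_mul_Kinv_mul_pow (n : ℕ) :
    (UqH.E q * UqH.Kinv q) ^ n = q ^ (n * (n + 1)) • (UqH.Kinv q ^ n * UqH.E q ^ n) := by
  induction n with
  | zero => simp
  | succ n ih =>
    have h : UqH.E q * UqH.Kinv q * (UqH.Kinv q ^ n * UqH.E q ^ n) =
        q ^ (2 * (n + 1)) • (UqH.Kinv q ^ (n + 1) * UqH.E q ^ (n + 1)) := by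
      rw [mul_assoc, ← mul_assoc (UqH.Kinv q), ← pow_succ', ← mul_assoc, E_mul_Kinv_pow,
        smul_mul_assoc, mul_assoc, ← pow_succ']
    rw [pow_succ', ih, mul_smul_comm, h, smul_smul]
    ring_nf

theorem antipode_E_pow_mul_Kinv_pow (n p : ℕ) :
    antipode q (UqH.E q ^ n * UqH.Kinv q ^ (n + p)) =
      ((-1) ^ n * q ^ (n * (n + 1))) • (UqH.K q ^ p * UqH.E q ^ n) := by
  rw [antipode_mul, antipode_pow, antipode_pow, antipode_gen, antipode_gen]
  change UqH.K q ^ (n + p) * (-(UqH.E q * UqH.Kinv q)) ^ n = _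
  have h : (-(UqH.E q * UqH.Kinv q)) ^ n = (-1 : ℂ) ^ n • (UqH.E q * UqH.Kinv q) ^ n := by
    rw [← smul_pow, neg_one_smul]
  rw [h, E_mul_Kinv_mul_pow, smul_smul, mul_smul_comm, add_comm n p, pow_add, mul_assoc,
    ← mul_assoc (UqH.K q ^ n), K_pow_mul_Kinv_pow, one_mul]

theorem ad_E_E_pow_mul_Kinv_pow (n p : ℕ) :
    ad q (UqH.E q) (UqH.E q ^ n * UqH.Kinv q ^ p) =
      (1 - (q ^ 2)⁻¹ ^ p) • (UqH.E q ^ (n + 1) * UqH.Kinv q ^ (p + 1)) := by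
  rw [ad_E, mul_assoc (UqH.E q ^ n), Kinv_pow_mul_E, mul_smul_comm, ← mul_assoc, ← mul_assoc,
    ← pow_succ, ← pow_succ', sub_smul, one_smul, sub_mul, smul_mul_assoc, mul_assoc, ← pow_succ]

theorem ad_E_pow_Kinv_pow (n p : ℕ) :
    ad q (UqH.E q ^ n) (UqH.Kinv q ^ p) =
      (∏ j ∈ Finset.range n, (1 - (q ^ 2)⁻¹ ^ (j + p))) •
        (UqH.E q ^ n * UqH.Kinv q ^ (n + p)) := by
  induction n with
  | zero => simp [ad_one]
  | succ n ih =>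
    rw [pow_succ' (UqH.E q), ad_mul, ih, ad_smul, ← pow_succ', ad_E_E_pow_mul_Kinv_pow, smul_smul,
      Finset.prod_range_succ, add_right_comm n 1 p]

/-! ### Summation of the braided antipode -/

theorem rep_gen (m : ℕ) (g : GenH) : rep q m (UqH.gen q g) = repGen q m g := by
  simp [rep, UqH.gen, UqH.lift_mk]

theorem rep_F_pow_eq_zero {m n : ℕ} (h : m < n) : rep q m (UqH.F q ^ n) = 0 := by
  -- `Fⁿ vᵢ = vᵢ₊ₙ`, so that the first `n` rows of the matrix of `Fⁿ` vanish.
  have hrows (n : ℕ) : ∀ j i : Fin (m + 1), (j : ℕ) < n → rep q m (UqH.F q ^ n) j i = 0 := by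
    induction n with
    | zero => simp
    | succ n ih =>
      intro j i hj
      rw [pow_succ', map_mul, Matrix.mul_apply]
      refine Finset.sum_eq_zero fun c _ => ?_
      by_cases hc : (c : ℕ) < n
      · rw [ih c i hc, mul_zero]
      · have : (j : ℕ) ≠ c + 1 := by omega
        simp [rep_gen, repGen, this]
  ext j i
  exact hrows n j i (by omega)

theorem rep_KUnit_zpow (m : ℕ) (z : ℤ) : rep q m (KUnit q ^ z : (UqH q)ˣ) =
    Matrix.diagonal fun i : Fin (m + 1) => q ^ (z * ((m : ℤ) - 2 * ((i : ℕ) : ℤ))) := by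
  have hpow (n : ℕ) : rep q m (UqH.K q ^ n) =
      Matrix.diagonal fun i : Fin (m + 1) => q ^ ((n : ℤ) * ((m : ℤ) - 2 * ((i : ℕ) : ℤ))) := by
    rw [map_pow, rep_gen, repGen, Matrix.diagonal_pow]
    congr 1; ext i
    rw [Pi.pow_apply, ← zpow_natCast, ← zpow_mul, mul_comm]
  have hpow' (n : ℕ) : rep q m (UqH.Kinv q ^ n) =
      Matrix.diagonal fun i : Fin (m + 1) => q ^ (-(n : ℤ) * ((m : ℤ) - 2 * ((i : ℕ) : ℤ))) := by
    rw [map_pow, rep_gen, repGen, Matrix.diagonal_pow]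
    congr 1; ext i
    rw [Pi.pow_apply, ← zpow_natCast, ← zpow_mul, mul_comm, neg_mul, mul_neg]
  obtain ⟨n, rfl | rfl⟩ := z.eq_nat_or_neg
  · rw [zpow_natCast, Units.val_pow_eq_pow_val]
    exact hpow n
  · rw [zpow_neg, zpow_natCast, ← inv_pow, Units.val_pow_eq_pow_val]
    exact hpow' n

variable {q} in
/-- The relation `q ^ (z H) = K ^ z`, which holds in every `Vₘ`. -/
theorem hasSum_rep_H_pow {lnq : ℂ} (hlnq : Complex.exp lnq = q) (m : ℕ) (z : ℤ) :
    HasSum (fun l : ℕ => ((lnq / 2) ^ l / (l.factorial : ℂ) * (2 * (z : ℂ)) ^ l) •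
      rep q m (UqH.H q ^ l)) (rep q m (KUnit q ^ z : (UqH q)ˣ)) := by
  rw [rep_KUnit_zpow]
  have h (l : ℕ) : ((lnq / 2) ^ l / (l.factorial : ℂ) * (2 * (z : ℂ)) ^ l) •
      rep q m (UqH.H q ^ l) = Matrix.diagonal fun i : Fin (m + 1) =>
        (lnq * ((z * ((m : ℤ) - 2 * ((i : ℕ) : ℤ)) : ℤ) : ℂ)) ^ l / (l.factorial : ℂ) := by
    rw [map_pow, rep_gen, repGen, Matrix.diagonal_pow, ← Matrix.diagonal_smul]
    congr 1; ext i
    simp only [Pi.smul_apply, Pi.pow_apply, smul_eq_mul]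
    push_cast
    rw [div_mul_eq_mul_div, div_mul_eq_mul_div, ← mul_pow, ← mul_pow]
    ring_nf
  simp_rw [h]
  refine HasSum.matrix_diagonal (Pi.hasSum.2 fun i => ?_)
  rw [← hlnq, ← Complex.exp_int_mul, mul_comm, Complex.exp_eq_exp_ℂ]
  exact NormedSpace.expSeries_div_hasSum_exp _

/-- A series over pairs with finitely many nonzero rows is summed row by row. -/
theorem hasSum_prod_of_finite_rows {M : Type*} [AddCommMonoid M] [TopologicalSpace M]
    [ContinuousAdd M] {f : ℕ × ℕ → M} {g : ℕ → M} {s : Finset ℕ}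
    (hf : ∀ n, HasSum (fun l => f (n, l)) (g n)) (hs : ∀ n ∉ s, ∀ l, f (n, l) = 0) :
    HasSum f (∑ n ∈ s, g n) := by
  have hrow (n : ℕ) : HasSum (fun p : ℕ × ℕ => if p.1 = n then f p else 0) (g n) := by
    have hinj : Function.Injective fun l : ℕ => (n, l) := fun _ _ h => (Prod.ext_iff.1 h).2
    rw [← hinj.hasSum_iff]
    · simpa [Function.comp_def] using hf n
    · rintro ⟨n', l⟩ h
      rw [if_neg]
      rintro rfl
      exact h ⟨l, rfl⟩
  convert hasSum_sum fun n (_ : n ∈ s) => hrow n using 1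
  ext ⟨n, l⟩
  by_cases h : n ∈ s
  · simp [h]
  · simp [hs n h l]

/-- The sum over `l` of the terms with index `(n, l)` of the series for the braided antipode of an
element `a` of weight `2 k`. It lies in `UqH q` rather than only in the completion, because the
exponential series in `H` is replaced by the power `K ^ (k + n)`. -/
def braidedAntipodeRow (a : UqH q) (k : ℤ) (n : ℕ) : UqH q :=
  RCoeff q n • (((KUnit q ^ (k + n) : (UqH q)ˣ) : UqH q) * UqH.F q ^ n *
    antipode q (ad q (UqH.E q ^ n) a))

variable {q} in
/-- The double series for the braided antipode of an element of even weight converges, and to the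
same sum as the series of its rows. -/
theorem exists_hasSum_braidedAntipode {lnq : ℂ} (hlnq : Complex.exp lnq = q) (a : Uq q) (k : ℤ)
    (ha : ad q (UqH.H q) (incl q a) = (2 * k : ℂ) • incl q a) :
    ∃ s, HasSum (braidedAntipodeTerm q lnq a) s ∧
      HasSum (fun n => toCompletion q (braidedAntipodeRow q (incl q a) k n)) s := by
  set x : ℕ → UqH q := fun n => antipode q (ad q (UqH.E q ^ n) (incl q a)) with hx
  have hterm (m n l : ℕ) : braidedAntipodeTerm q lnq a (n, l) m =
      (((lnq / 2) ^ l / (l.factorial : ℂ) * (2 * ((k + n : ℤ) : ℂ)) ^ l) •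
        rep q m (UqH.H q ^ l)) * (RCoeff q n • rep q m (UqH.F q ^ n * x n)) := by
    have : braidedAntipodeTerm q lnq a (n, l) m = rep q m
        (antipodeFormula q (incl q a) (RTerm q lnq (n, l))) := rfl
    have happ (r₁ r₂ : UqH q) : antipodeFormula q (incl q a) (r₁ ⊗ₜ r₂) =
        r₂ * antipode q (ad q r₁ (incl q a)) := rfl
    rw [this]
    simp only [RTerm, map_smul, happ, ad_H_pow_mul_E_pow ha, mul_smul_comm, smul_mul_assoc,
      smul_smul, map_mul, mul_assoc, hx, RCoeff]
    push_cast
    ring_nf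
  have hrow (m n : ℕ) : rep q m (braidedAntipodeRow q (incl q a) k n) =
      rep q m (KUnit q ^ (k + n) : (UqH q)ˣ) * (RCoeff q n • rep q m (UqH.F q ^ n * x n)) := by
    simp [braidedAntipodeRow, hx, mul_assoc]
  have hzero {m n : ℕ} (h : n ∉ Finset.range (m + 1)) : rep q m (UqH.F q ^ n * x n) = 0 := by
    rw [map_mul, rep_F_pow_eq_zero q (by simpa using h), zero_mul]
  refine ⟨fun m => ∑ n ∈ Finset.range (m + 1), rep q m (braidedAntipodeRow q (incl q a) k n),
    Pi.hasSum.2 fun m => ?_, Pi.hasSum.2 fun m => ?_⟩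
  · refine hasSum_prod_of_finite_rows (fun n => ?_) fun n hn l => ?_
    · simp_rw [hterm, hrow]
      exact (hasSum_rep_H_pow hlnq m _).mul_right _
    · rw [hterm, hzero hn, smul_zero, mul_zero]
  · refine hasSum_sum_of_ne_finset_zero fun n hn => ?_
    change rep q m _ = 0
    rw [hrow, hzero hn, smul_zero, mul_zero]

/-! ### The coefficients -/

variable {q} in
theorem sub_inv_ne_zero_of_not_root_of_unity (hq : ∀ n : ℕ, 0 < n → q ^ n ≠ 1) :
    q - q⁻¹ ≠ 0 := by
  intro h
  refine hq 2 two_pos ?_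
  rw [sub_eq_zero] at h
  rw [pow_two]
  nth_rewrite 2 [h]
  exact mul_inv_cancel₀ (NeZero.ne q)

variable {q} in
theorem qNumber_succ_mul (hd : q - q⁻¹ ≠ 0) (n : ℕ) :
    qNumber q (n + 1) * (q - q⁻¹) = q ^ (n + 1) * (1 - (q ^ 2)⁻¹ ^ (n + 1)) := by
  have h0 : q ^ (n + 1) ≠ 0 := pow_ne_zero _ (NeZero.ne q)
  rw [qNumber, div_mul_cancel₀ _ hd, zpow_neg, ← Nat.cast_succ, zpow_natCast, inv_pow, ← pow_mul,
    mul_comm 2, pow_mul, Nat.succ_eq_add_one]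
  field_simp

variable {q} in
theorem qFactorial_mul (hd : q - q⁻¹ ≠ 0) (n : ℕ) :
    qFactorial q n * (q - q⁻¹) ^ n =
      q ^ (n * (n + 1) / 2) * ∏ j ∈ Finset.range n, (1 - (q ^ 2)⁻¹ ^ (j + 1)) := by
  induction n with
  | zero => simp [qFactorial]
  | succ n ih =>
    have h : (n + 1) * (n + 1 + 1) / 2 = n * (n + 1) / 2 + (n + 1) := by
      rw [show (n + 1) * (n + 1 + 1) = n * (n + 1) + (n + 1) * 2 by ring,
        Nat.add_mul_div_right _ _ two_pos]
    have hs : qFactorial q (n + 1) = qFactorial q n * qNumber q (n + 1) := by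
      simp [qFactorial, Finset.prod_range_succ]
    rw [hs, Finset.prod_range_succ, h, pow_add, pow_succ]
    linear_combination (qNumber q (n + 1) * (q - q⁻¹)) * ih +
      (q ^ (n * (n + 1) / 2) * ∏ j ∈ Finset.range n, (1 - (q ^ 2)⁻¹ ^ (j + 1))) *
        qNumber_succ_mul hd n

variable {q} in
/-- The factors `1 - q⁻²ʲ` produced by the iterated adjoint action of `E` cancel the `q`-factorial in
the `R`-matrix; `[n]_q!` does not vanish as `q` is not a root of unity. -/
theorem RCoeff_mul_prod (hq : ∀ n : ℕ, 0 < n → q ^ n ≠ 1) (n : ℕ) :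
    RCoeff q n * ∏ j ∈ Finset.range n, (1 - (q ^ 2)⁻¹ ^ (j + 1)) =
      q⁻¹ ^ n * (q - q⁻¹) ^ (2 * n) := by
  have hd := sub_inv_ne_zero_of_not_root_of_unity hq
  have h0 := NeZero.ne q
  have hf : qFactorial q n ≠ 0 := by
    refine left_ne_zero_of_mul (b := (q - q⁻¹) ^ n) ?_
    rw [qFactorial_mul hd]
    refine mul_ne_zero (pow_ne_zero _ h0) (Finset.prod_ne_zero_iff.2 fun j _ h => ?_)
    refine hq (2 * (j + 1)) (by omega) ?_
    rwa [sub_eq_zero, inv_pow, eq_comm, inv_eq_one, ← pow_mul] at h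
  have h1 : 1 - (q ^ 2)⁻¹ = q⁻¹ * (q - q⁻¹) := by field_simp
  rw [RCoeff, div_mul_eq_mul_div, div_eq_iff hf, h1, mul_pow, two_mul, pow_add]
  linear_combination (-(q⁻¹ ^ n * (q - q⁻¹) ^ n)) * qFactorial_mul hd n

variable {q} in
theorem RCoeff_one (hq : ∀ n : ℕ, 0 < n → q ^ n ≠ 1) : RCoeff q 1 = q - q⁻¹ := by
  have h0 := NeZero.ne q
  have hd := sub_inv_ne_zero_of_not_root_of_unity hq
  have h := RCoeff_mul_prod hq 1
  have h1 : 1 - (q ^ 2)⁻¹ = q⁻¹ * (q - q⁻¹) := by field_simp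
  simp only [Finset.range_one, Finset.prod_singleton, zero_add, pow_one, mul_one, h1] at h
  refine mul_right_cancel₀ (mul_ne_zero (inv_ne_zero h0) hd) (h.trans (by ring))

/-! ### The adjoint action of `E` and the rows for the generators -/

theorem antipode_K : antipode q (UqH.K q) = UqH.Kinv q := antipode_gen q _

theorem antipode_E : antipode q (UqH.E q) = -(UqH.E q * UqH.Kinv q) := antipode_gen q _

theorem antipode_F : antipode q (UqH.F q) = -(UqH.K q * UqH.F q) := antipode_gen q _

theorem ad_E_E : ad q (UqH.E q) (UqH.E q) = 0 := by rw [ad_E, sub_self, zero_mul]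

theorem ad_E_K : ad q (UqH.E q) (UqH.K q) = (1 - q ^ 2) • UqH.E q := by
  rw [ad_E, UqH.K_E, sub_mul, smul_mul_assoc, mul_assoc, UqH.K_Kinv, mul_one, sub_smul, one_smul]

theorem ad_E_F : ad q (UqH.E q) (UqH.F q) = (q - q⁻¹)⁻¹ • (1 - UqH.Kinv q ^ 2) := by
  rw [ad_E, UqH.E_F, smul_mul_assoc, sub_mul, UqH.K_Kinv, pow_two]

theorem ad_E_pow_one (n : ℕ) : ad q (UqH.E q ^ (n + 1)) 1 = 0 := by
  rw [pow_succ, ad_mul, ad_E, mul_one, one_mul, sub_self, zero_mul, ad_zero]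

theorem K_pow_mul_F_pow_mul_K_pow (r N p : ℕ) (x : UqH q) :
    UqH.K q ^ r * UqH.F q ^ N * (UqH.K q ^ p * x) =
      q ^ (2 * N * p) • (UqH.K q ^ (r + p) * UqH.F q ^ N * x) := by
  rw [mul_assoc, ← mul_assoc (UqH.F q ^ N), F_pow_mul_K_pow, smul_mul_assoc, mul_smul_comm,
    pow_add]
  simp only [mul_assoc]

theorem braidedAntipodeRow_E_zero :
    braidedAntipodeRow q (UqH.E q) 1 0 = -(q ^ 2 • UqH.E q) := by
  have h := KUnit_zpow_natCast q 1
  rw [braidedAntipodeRow, RCoeff_zero, one_smul, pow_zero, pow_zero, ad_one, mul_one, antipode_E,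
    show (1 + (0 : ℕ) : ℤ) = (1 : ℕ) by rfl, h, pow_one, mul_neg, ← mul_assoc, UqH.K_E,
    smul_mul_assoc, mul_assoc, UqH.K_Kinv, mul_one]

theorem braidedAntipodeRow_E_succ (n : ℕ) : braidedAntipodeRow q (UqH.E q) 1 (n + 1) = 0 := by
  rw [braidedAntipodeRow, pow_succ (UqH.E q), ad_mul, ad_E_E, ad_zero, map_zero, mul_zero,
    smul_zero]

theorem braidedAntipodeRow_K_zero : braidedAntipodeRow q (UqH.K q) 0 0 = UqH.Kinv q := by
  simp [braidedAntipodeRow, RCoeff_zero, ad_one, antipode_K]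

variable {q} in
theorem braidedAntipodeRow_K_one (hq : ∀ n : ℕ, 0 < n → q ^ n ≠ 1) :
    braidedAntipodeRow q (UqH.K q) 0 1 = (q * (q - q⁻¹) ^ 2) • (UqH.F q * UqH.E q) := by
  have h0 := NeZero.ne q
  have hFE : UqH.K q * UqH.F q * (UqH.E q * UqH.Kinv q) = UqH.F q * UqH.E q := by
    rw [UqH.K_F, UqH.E_Kinv, smul_mul_smul_comm, inv_mul_cancel₀ (pow_ne_zero 2 h0), one_smul,
      mul_assoc, ← mul_assoc (UqH.K q), UqH.K_Kinv, one_mul]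
  rw [braidedAntipodeRow, RCoeff_one hq, zero_add, KUnit_zpow_natCast, pow_one, pow_one, pow_one,
    ad_E_K, map_smul, antipode_E, smul_neg, mul_neg, mul_smul_comm, hFE, ← neg_smul, smul_smul]
  congr 1
  field_simp
  ring

theorem braidedAntipodeRow_K_add_two (n : ℕ) : braidedAntipodeRow q (UqH.K q) 0 (n + 2) = 0 := by
  rw [braidedAntipodeRow, pow_succ (UqH.E q), pow_succ (UqH.E q), ad_mul, ad_mul, ad_E_K,
    ad_smul, ad_E_E, smul_zero, ad_zero, map_zero, mul_zero, smul_zero]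

variable {q} in
theorem braidedAntipodeRow_Kinv (hq : ∀ n : ℕ, 0 < n → q ^ n ≠ 1) (n : ℕ) :
    braidedAntipodeRow q (UqH.Kinv q) 0 n =
      ((-1) ^ n * q ^ (n ^ 2 + 2 * n) * (q - q⁻¹) ^ (2 * n)) •
        (UqH.K q ^ (n + 1) * UqH.F q ^ n * UqH.E q ^ n) := by
  have h0 := NeZero.ne q
  have h := ad_E_pow_Kinv_pow q n 1
  rw [pow_one] at h
  rw [braidedAntipodeRow, zero_add, KUnit_zpow_natCast, h, map_smul, antipode_E_pow_mul_Kinv_pow,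
    mul_smul_comm, mul_smul_comm, K_pow_mul_F_pow_mul_K_pow, smul_smul, smul_smul, smul_smul,
    RCoeff_mul_prod hq]
  congr 1
  have hexp : q⁻¹ ^ n * (q ^ (n * (n + 1)) * q ^ (2 * n * 1)) = q ^ (n ^ 2 + 2 * n) := by
    rw [inv_pow, inv_mul_eq_iff_eq_mul₀ (pow_ne_zero _ h0), ← pow_add, ← pow_add]
    ring_nf
  rw [← hexp]
  ring

theorem braidedAntipodeRow_F_zero : braidedAntipodeRow q (UqH.F q) (-1) 0 = -UqH.F q := by
  have h : ((KUnit q ^ (-1 : ℤ) : (UqH q)ˣ) : UqH q) = UqH.Kinv q := by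
    rw [zpow_neg_one]; rfl
  rw [braidedAntipodeRow, RCoeff_zero, one_smul, Nat.cast_zero, add_zero, h, pow_zero, pow_zero,
    ad_one, antipode_F, mul_one, mul_neg, ← mul_assoc, UqH.Kinv_K, one_mul]

variable {q} in
/-- The row of index `n + 1` is the `n`-th term of the stated series, except that the constant term
of `E ▷ F` contributes an additional `F` to the row of index `1`, which cancels the row of
index `0`. -/
theorem braidedAntipodeRow_F_succ (hq : ∀ n : ℕ, 0 < n → q ^ n ≠ 1) (n : ℕ) :
    braidedAntipodeRow q (UqH.F q) (-1) (n + 1) =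
      ((-1) ^ (n + 1) * q ^ (n ^ 2 + 4 * n + 4) * (q - q⁻¹) ^ (2 * n)) •
        (UqH.K q ^ (n + 2) * UqH.F q ^ (n + 1) * UqH.E q ^ n) +
      if n = 0 then UqH.F q else 0 := by
  have h0 := NeZero.ne q
  have hd := sub_inv_ne_zero_of_not_root_of_unity hq
  set c : ℂ := ∏ j ∈ Finset.range n, (1 - (q ^ 2)⁻¹ ^ (j + 2)) with hc
  -- The product over `j < n + 1` starting from `1 - q⁻²` has `c` as its tail.
  have hcoef : RCoeff q (n + 1) * ((q - q⁻¹)⁻¹ * c) = q⁻¹ ^ n * (q - q⁻¹) ^ (2 * n) := by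
    have h1 : 1 - (q ^ 2)⁻¹ = q⁻¹ * (q - q⁻¹) := by field_simp
    have h := RCoeff_mul_prod hq (n + 1)
    rw [Finset.prod_range_succ'] at h
    simp only [zero_add, pow_one, h1, add_assoc, one_add_one_eq_two, ← hc] at h
    rw [mul_add, mul_one, pow_add (q - q⁻¹), pow_succ q⁻¹] at h
    have hne : q⁻¹ * (q - q⁻¹) * (q - q⁻¹) ≠ 0 := mul_ne_zero (mul_ne_zero (inv_ne_zero h0) hd) hd
    refine mul_right_cancel₀ hne ?_
    linear_combination h + RCoeff q (n + 1) * c * q⁻¹ * (q - q⁻¹) * inv_mul_cancel₀ hd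
  have hexp : q⁻¹ ^ n * (q ^ (n * (n + 1)) * q ^ (2 * (n + 1) * 2)) = q ^ (n ^ 2 + 4 * n + 4) := by
    rw [inv_pow, inv_mul_eq_iff_eq_mul₀ (pow_ne_zero _ h0), ← pow_add, ← pow_add]
    ring_nf
  have hone : ad q (UqH.E q ^ n) 1 = if n = 0 then 1 else 0 := by
    cases n with
    | zero => simp [ad_one]
    | succ n => simp [ad_E_pow_one]
  have hfirst : (RCoeff q (n + 1) * (q - q⁻¹)⁻¹) •
      (UqH.K q ^ n * UqH.F q ^ (n + 1) * antipode q (ad q (UqH.E q ^ n) 1)) =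
        if n = 0 then UqH.F q else 0 := by
    rw [hone]
    split_ifs with hn
    · subst hn
      simp [antipode_one, RCoeff_one hq, hd]
    · simp
  rw [← hfirst, braidedAntipodeRow, pow_succ (UqH.E q), ad_mul, ad_E_F, ad_smul, ad_sub,
    ad_E_pow_Kinv_pow, ← hc, map_smul, map_sub, map_smul, antipode_E_pow_mul_Kinv_pow,
    show (-1 + (n + 1 : ℕ) : ℤ) = n by push_cast; ring, KUnit_zpow_natCast, mul_smul_comm,
    mul_sub, mul_smul_comm, mul_smul_comm, K_pow_mul_F_pow_mul_K_pow, smul_sub, smul_sub,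
    smul_smul, sub_eq_neg_add]
  congr 1
  rw [smul_smul, smul_smul, smul_smul, smul_smul, ← neg_smul]
  congr 1
  rw [← hexp]
  linear_combination (-((-1) ^ n * q ^ (n * (n + 1)) * q ^ (2 * (n + 1) * 2))) * hcoef

/-! ### The values on the generators -/

theorem Kinv_add_F_mul_E_eq_casimir (hd : q - q⁻¹ ≠ 0) :
    Uq.Kinv q + (q * (q - q⁻¹) ^ 2) • (Uq.F q * Uq.E q) =
      -(q ^ 2 • Uq.K q) + (q * (q - q⁻¹) ^ 2) • Uq.casimir q := by
  have hEF : Uq.E q * Uq.F q = (q - q⁻¹)⁻¹ • (Uq.K q - Uq.Kinv q) + Uq.F q * Uq.E q := by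
    rw [← sub_eq_iff_eq_add]
    simpa only [Uq.gen, map_mul, map_smul, map_sub] using Uq.mk_rel (Rel.E_F (q := q))
  have h0 := NeZero.ne q
  have hd2 : q ^ 2 - 1 ≠ 0 := by
    intro h
    apply hd
    field_simp
    rw [h, mul_zero]
  rw [Uq.casimir, hEF]
  match_scalars <;> field_simp <;> ring

variable {q} in
/-- The braided antipode of a generator is the sum of its rows, all in `UqH q`. -/
theorem hasSum_braidedAntipode_gen {lnq : ℂ} (hlnq : Complex.exp lnq = q) (g : Gen) :
    HasSum (fun n => toCompletion q (braidedAntipodeRow q (incl q (Uq.gen q g))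
      (Gen.halfWeight g) n))
      (braidedAntipode q lnq (Uq.gen q g)) ∧
    Summable (braidedAntipodeTerm q lnq (Uq.gen q g)) := by
  obtain ⟨s, hs, hs'⟩ := exists_hasSum_braidedAntipode hlnq (Uq.gen q g)
    (Gen.halfWeight g) (by
      rw [incl_gen, ad_H]
      cases g
      · simp [Gen.halfWeight, UqH.H_K]
      · simp [Gen.halfWeight, UqH.H_Kinv]
      · simp [Gen.halfWeight, UqH.H_E]
      · simp [Gen.halfWeight, UqH.H_F])
  rw [braidedAntipode, hs.tsum_eq]
  exact ⟨hs', hs.summable⟩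

end BraidedUq

end

open BraidedUq in
theorem theorem4p1 (q : ℂ) [NeZero q] (hq : ∀ n : ℕ, 0 < n → q ^ n ≠ 1)
    (lnq : ℂ) (hlnq : Complex.exp lnq = q) :
    -- the series defining the braided antipode converges on each generator
    (∀ g : Gen, Summable (braidedAntipodeTerm q lnq (Uq.gen q g))) ∧
    -- the value on `E`
    braidedAntipode q lnq (Uq.E q) = Uq.toCompletion q (-(q ^ 2 • Uq.E q)) ∧
    -- the value on `K`, in two forms
    braidedAntipode q lnq (Uq.K q) =
      Uq.toCompletion q (Uq.Kinv q + (q * (q - q⁻¹) ^ 2) • (Uq.F q * Uq.E q)) ∧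
    Uq.Kinv q + (q * (q - q⁻¹) ^ 2) • (Uq.F q * Uq.E q) =
      -(q ^ 2 • Uq.K q) + (q * (q - q⁻¹) ^ 2) • Uq.casimir q ∧
    -- the value on `K⁻¹`
    HasSum (fun n : ℕ => Uq.toCompletion q
        (((-1) ^ n * q ^ (n ^ 2 + 2 * n) * (q - q⁻¹) ^ (2 * n)) •
          (Uq.K q ^ (n + 1) * Uq.F q ^ n * Uq.E q ^ n)))
      (braidedAntipode q lnq (Uq.Kinv q)) ∧
    -- the value on `F`
    HasSum (fun n : ℕ => Uq.toCompletion q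
        (((-1) ^ (n + 1) * q ^ (n ^ 2 + 4 * n + 4) * (q - q⁻¹) ^ (2 * n)) •
          (Uq.K q ^ (n + 2) * Uq.F q ^ (n + 1) * Uq.E q ^ n)))
      (braidedAntipode q lnq (Uq.F q)) := by
  have hrow := hasSum_braidedAntipode_gen hlnq
  have hcompl (x : Uq q) : Uq.toCompletion q x = toCompletion q (incl q x) := rfl
  refine ⟨fun g => (hrow g).2, ?_, ?_,
    Kinv_add_F_mul_E_eq_casimir q (sub_inv_ne_zero_of_not_root_of_unity hq), ?_, ?_⟩
  · have h := (hrow Gen.E).1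
    simp only [incl_gen, Gen.halfWeight] at h
    refine h.unique ?_
    have hval := hasSum_single (f := fun n => toCompletion q (braidedAntipodeRow q (UqH.E q) 1 n))
      0 fun n hn => by
        obtain ⟨n, rfl⟩ := Nat.exists_eq_succ_of_ne_zero hn
        rw [Nat.succ_eq_add_one, braidedAntipodeRow_E_succ, map_zero]
    rw [braidedAntipodeRow_E_zero] at hval
    simpa only [hcompl, map_neg, map_smul, incl_gen] using hval
  · have h := (hrow Gen.K).1
    simp only [incl_gen, Gen.halfWeight] at h
    refine h.unique ?_
    have hval := hasSum_sum_of_ne_finset_zero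
      (f := fun n => toCompletion q (braidedAntipodeRow q (UqH.K q) 0 n))
      (s := Finset.range 2) (L := .unconditional ℕ) fun n hn => by
        obtain ⟨n, rfl⟩ := Nat.exists_eq_add_of_le' (not_lt.1 (mt Finset.mem_range.2 hn))
        rw [braidedAntipodeRow_K_add_two, map_zero]
    rw [Finset.sum_range_succ, Finset.sum_range_one, braidedAntipodeRow_K_zero,
      braidedAntipodeRow_K_one hq] at hval
    simpa only [hcompl, map_add, map_mul, map_smul, incl_gen] using hval
  · have h := (hrow Gen.Kinv).1
    simp only [incl_gen, Gen.halfWeight, braidedAntipodeRow_Kinv hq] at h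
    simpa only [hcompl, map_mul, map_smul, map_pow, incl_gen] using h
  · have h := (hrow Gen.F).1
    simp only [incl_gen, Gen.halfWeight] at h
    -- Drop the row `-F` of index `0` together with the extra `F` in the row of index `1`.
    rw [← hasSum_nat_add_iff' 1, Finset.sum_range_one, braidedAntipodeRow_F_zero] at h
    simp only [braidedAntipodeRow_F_succ hq] at h
    have h' := h.sub (hasSum_ite_eq 0 (toCompletion q (UqH.F q)))
    rw [map_neg, sub_neg_eq_add, add_sub_cancel_right] at h'
    refine (congrArg (HasSum · _) (funext fun n => ?_)).mp h'
    simp only [hcompl, map_add, map_mul, map_smul, map_pow, incl_gen]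
    split_ifs <;> simp
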